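/- **Setting.** A multicast game consists of a finite connected undirected graph $G=(V,E)$, a root $t\in V$, edge costs $c_e\ge 0$ (real), and a set $S\subseteq V\setminus\{t\}$ of activated vertices (the players). Each player $i\in S$ chooses a path $P_i$ in $G$ from $i$ to $t$; the outcome $\mathbf P=(P_i)_{i\in S}$ costs $c(\mathbf P)=\sum_{e\in\bigcup_i P_i}c_e$. The ordered cost-sharing protocol of a total order $\pi$ of $V$ charges the full cost $c_e$ of every used edge $e$ to that one of the players using $e$ who comes first in $\pi$. A Nash equilibrium is an outcome in which no player can lower the sum of her charges by changing only her own path. The price of anarchy (PoA) of the protocol on $G$ with root $t$ is the maximum, over all $S\subseteq V\setminus\{t\}$ and all Nash equilibria $\mathbf P$ of the game for $S$, of $c(\mathbf P)/\min_{\mathbf P'}c(\mathbf P')$, where $\mathbf P'$ runs over all outcomes for $S$ (with $0/0=0$ and $a/0=\infty$ for $a>0$). A graph is outerplanar if it can be drawn with its vertices at distinct points of a circle and its edges as straight chords that do not cross. It is biconnected if it has at least three vertices, is connected, and remains connected after the deletion of any single vertex. **Theorem.** Let $G$ be a connected outerplanar graph on a vertex set $V$ with $3\le|V|<\infty$, with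 edge costs $c_e\ge 0$ and root $t\in V$. Then there is a biconnected outerplanar graph $H$ on $V$ that contains $G$ as a subgraph ($H=G$ is possible if $G$ is biconnected). Moreover, every such $H$ has a Hamiltonian cycle, and its edge set is unique. Let $\Xi_{tour}$ be the ordered protocol whose order is that in which the vertices appear along this cycle, starting from $t$ (in either of the two directions). Then, in the game on $G$, for every $S\subseteq V\setminus\{t\}$ there is a Nash equilibrium under $\Xi_{tour}$, and the PoA of $\Xi_{tour}$ on $G$ with root $t$ is at most $8$. That is, for every $S\subseteq V\setminus\{t\}$ every Nash equilibrium of the game for $S$ costs at most $8$ times the minimum cost of an outcome for $S$. -/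

import Mathlib

open scoped NNReal ENNReal

namespace Multicast

variable {V : Type*}

/-- `G` is outerplanar: it has a plane drawing in a closed disk with all vertices on the boundary
circle (hence on the outer face), the edges being straight chords. Two chords with a common endpoint
meet in that endpoint only, so it suffices to ask that edges without a common endpoint be disjoint. -/
def IsOuterplanar (G : SimpleGraph V) : Prop :=
  ∃ p : V → Circle, Function.Injective p ∧
    ∀ a b x y : V, G.Adj a b → G.Adj x y → a ≠ x → a ≠ y → b ≠ x → b ≠ y →
      Disjoint (segment ℝ (p a : ℂ) (p b : ℂ)) (segment ℝ (p x : ℂ) (p y : ℂ))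

/-- `G` is biconnected: it has at least three vertices, is connected, and stays connected when any
one vertex is deleted. -/
structure IsBiconnected [Fintype V] (G : SimpleGraph V) : Prop where
  three_le_card : 3 ≤ Fintype.card V
  connected : G.Connected
  connected_delete : ∀ v : V, (G.induce {v}ᶜ).Connected

/-- A cost-sharing protocol: `ξ e i R` is the share of the edge `e` that the player at vertex `i`
pays when `R` is the set of players using `e`. It does not depend on the activated set. -/
abbrev Protocol (V : Type*) := Sym2 V → V → Finset V → ℝ≥0

variable [DecidableEq V]

/-- The ordered protocol for edge costs `c` and an (injective) labelling `π` of the vertices: the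
full cost of an edge is paid by that one of its users who comes first in the order. -/
def orderedProtocol (c : Sym2 V → ℝ≥0) (π : V → ℕ) : Protocol V :=
  fun e i R => if i ∈ R ∧ ∀ j ∈ R, π i ≤ π j then c e else 0

/-- The position of a vertex on a closed tour from `t`; the root has position `0`. -/
def tourPosition {H : SimpleGraph V} {t : V} (p : H.Walk t t) (v : V) : ℕ :=
  p.support.idxOf v

/-- The protocol that orders the vertices as they appear on the tour `p` from the root `t`. -/
def tourProtocol (c : Sym2 V → ℝ≥0) {H : SimpleGraph V} {t : V} (p : H.Walk t t) : Protocol V :=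
  orderedProtocol c (tourPosition p)

section Game

variable (G : SimpleGraph V) (t : V) (S : Finset V)

/-- An outcome: every player, i.e. every activated vertex, chooses a path in `G` to the root. -/
abbrev Outcome := (i : S) → G.Path (i : V) t

variable {G t S}

/-- The edges of a path. -/
def pathEdges {u v : V} (P : G.Path u v) : Finset (Sym2 V) := P.1.edges.toFinset

/-- The set of players using the edge `e` in the outcome `P`. -/
def users (P : Outcome G t S) (e : Sym2 V) : Finset V :=
  (Finset.univ.filter fun i : S => e ∈ pathEdges (P i)).map (Function.Embedding.subtype _)

/-- The cost share of player `i` in the outcome `P`. -/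
def playerCost (ξ : Protocol V) (P : Outcome G t S) (i : S) : ℝ≥0 :=
  ∑ e ∈ pathEdges (P i), ξ e i (users P e)

/-- The cost of an outcome: the total cost of the union of the chosen paths. -/
def outcomeCost (c : Sym2 V → ℝ≥0) (P : Outcome G t S) : ℝ≥0 :=
  ∑ e ∈ Finset.univ.biUnion (fun i : S => pathEdges (P i)), c e

/-- `P` is a pure Nash equilibrium: no player has a cheaper path, the others' paths being fixed. -/
def IsNash (ξ : Protocol V) (P : Outcome G t S) : Prop :=
  ∀ (i : S) (Q : G.Path (i : V) t), playerCost ξ P i ≤ playerCost ξ (Function.update P i Q) i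

variable (G t S)

/-- The minimum cost of an outcome (that is, of a Steiner tree for `S ∪ {t}`). -/
noncomputable def optCost (c : Sym2 V → ℝ≥0) : ℝ≥0∞ :=
  ⨅ P : Outcome G t S, (outcomeCost c P : ℝ≥0∞)

/-- The price of anarchy of `ξ` on `G` with root `t`: the worst ratio, over all activated sets and all
Nash equilibria, of the cost of the equilibrium to the optimal cost. In `ℝ≥0∞` one has `0 / 0 = 0`,
and `a / 0 = ∞` for `a ≠ 0`. -/
noncomputable def priceOfAnarchy (c : Sym2 V → ℝ≥0) (ξ : Protocol V) : ℝ≥0∞ :=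
  ⨆ (S : Finset V) (_ : t ∉ S) (P : Outcome G t S) (_ : IsNash ξ P),
    (outcomeCost c P : ℝ≥0∞) / optCost G t S c

end Game

end Multicast

namespace Multicast

/-! Chords of a circle cross exactly when their ends interleave, so outerplanarity becomes a
condition on a numbering of the vertices (`exists_equiv_drawing_iff`). Adding the outer cycle
creates no interleaving; this gives `H`. Conversely, a biconnected `H` contains the outer cycle
(`NonCrossing.cyclicGraph_le`). Every Hamiltonian cycle of `H` is itself biconnected, so it contains
the outer cycle too and equals it. Hence the tour order is the drawing order up to rotation and
reflection, and nothing interleaves along it (`NonCrossing.of_cyclicGraph_le`).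

For the price of anarchy, let each player walk to her predecessor in the tour order among the
players and `t`, and from there follow the predecessor's path for free. In equilibrium she pays at
most the cost of the first piece, which can be taken in a spanning forest of any competing outcome.
Deleting a forest edge leaves components that do not interleave along the tour, so the edge lies on
at most two of these pieces, one per direction (`NonCrossing.card_filter_mem_edges_le_two`).
Summation gives the factor 2. Equilibria arise when the players choose best responses in the order
of the protocol. -/

/-- No two edges of `G` interleave in the linear order of the vertices given by `r`. -/
def NonCrossing {V α : Type*} [LinearOrder α] (G : SimpleGraph V) (r : V → α) : Prop :=
  ∀ a b x y : V, G.Adj a b → G.Adj x y → r a < r x → r x < r b → ¬ r b < r y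

/-! ### Crossing chords of a circle -/

/-- Twice the signed area of the triangle `a b z`. -/
def orient (a b z : ℂ) : ℝ :=
  (b.re - a.re) * (z.im - a.im) - (b.im - a.im) * (z.re - a.re)

theorem sin_add_sin_sub_sin_add (x y : ℝ) :
    Real.sin (2 * x) + Real.sin (2 * y) - Real.sin (2 * x + 2 * y) =
      4 * Real.sin x * Real.sin y * Real.sin (x + y) := by
  have hx := Real.sin_sq_add_cos_sq x
  have hy := Real.sin_sq_add_cos_sq y
  simp only [Real.sin_add, Real.sin_two_mul, Real.cos_two_mul]
  linear_combination (-4 * Real.sin y * Real.cos y) * hx - (4 * Real.sin x * Real.cos x) * hy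

theorem orient_circle (a b c : Circle) :
    orient a b c = 4 * Real.sin ((Complex.arg b - Complex.arg a) / 2) *
      Real.sin ((Complex.arg c - Complex.arg b) / 2) *
      Real.sin ((Complex.arg c - Complex.arg a) / 2) := by
  have h := sin_add_sin_sub_sin_add ((Complex.arg b - Complex.arg a) / 2)
    ((Complex.arg c - Complex.arg b) / 2)
  have re (z : Circle) : (z : ℂ).re = Real.cos (Complex.arg z) := by
    rw [Complex.cos_arg (Circle.coe_ne_zero z), Circle.norm_coe, div_one]
  have im (z : Circle) : (z : ℂ).im = Real.sin (Complex.arg z) := by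
    rw [Complex.sin_arg, Circle.norm_coe, div_one]
  have e : (Complex.arg b - Complex.arg a) / 2 + (Complex.arg c - Complex.arg b) / 2 =
      (Complex.arg c - Complex.arg a) / 2 := by ring
  rw [e] at h
  rw [← h, orient, re, re, re, im, im, im,
    show 2 * ((Complex.arg b - Complex.arg a) / 2) + 2 * ((Complex.arg c - Complex.arg b) / 2) =
      Complex.arg c - Complex.arg a by ring,
    mul_div_cancel₀ _ (two_ne_zero), mul_div_cancel₀ _ (two_ne_zero)]
  simp only [Real.sin_sub]
  ring

/-- All three half-differences of arguments lie in (0, π), so every sine in `orient_circle` is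
positive. -/
theorem orient_pos {a b c : Circle} (hab : Complex.arg a < Complex.arg b)
    (hbc : Complex.arg b < Complex.arg c) : 0 < orient a b c := by
  have ha := Complex.neg_pi_lt_arg a
  have hc := Complex.arg_le_pi c
  rw [orient_circle]
  have h1 := Real.sin_pos_of_pos_of_lt_pi (x := (Complex.arg b - Complex.arg a) / 2)
    (by linarith) (by linarith)
  have h2 := Real.sin_pos_of_pos_of_lt_pi (x := (Complex.arg c - Complex.arg b) / 2)
    (by linarith) (by linarith)
  have h3 := Real.sin_pos_of_pos_of_lt_pi (x := (Complex.arg c - Complex.arg a) / 2)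
    (by linarith) (by linarith)
  positivity

theorem orient_rotate (a b c : ℂ) : orient b c a = orient a b c := by
  simp only [orient]; ring

theorem orient_swap (a b c : ℂ) : orient a c b = -orient a b c := by
  simp only [orient]; ring

theorem not_disjoint_segment {a x b y : Circle} (h1 : Complex.arg a < Complex.arg x)
    (h2 : Complex.arg x < Complex.arg b) (h3 : Complex.arg b < Complex.arg y) :
    ¬ Disjoint (segment ℝ (a : ℂ) b) (segment ℝ (x : ℂ) y) := by
  have p1 : 0 < orient a x b := orient_pos h1 h2
  have p2 : 0 < orient a b y := orient_pos (h1.trans h2) h3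
  have p3 : 0 < orient x b y := orient_pos h2 h3
  have p4 : 0 < orient a x y := orient_pos h1 (h2.trans h3)
  have e : orient a x b + orient a b y = orient x b y + orient a x y := by
    simp only [orient]; ring
  have hD : 0 < orient a x b + orient a b y := by positivity
  rw [Set.not_disjoint_iff]
  -- The diagonals of the convex quadrilateral `a x b y` meet where each endpoint is weighted by the
  -- area of the triangle on the other three vertices; `e` is the total area computed from either
  -- diagonal.
  refine ⟨(orient x b y / (orient a x b + orient a b y)) • (a : ℂ) +
    (orient a x y / (orient a x b + orient a b y)) • (b : ℂ),
    ⟨_, _, by positivity, by positivity, ?_, rfl⟩,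
    ⟨orient a b y / (orient a x b + orient a b y), orient a x b / (orient a x b + orient a b y),
      by positivity, by positivity, ?_, ?_⟩⟩
  · rw [← add_div, ← e, div_self hD.ne']
  · rw [← add_div, add_comm (orient _ _ _), div_self hD.ne']
  · apply Complex.ext
    all_goals
      simp only [Complex.add_re, Complex.add_im, Complex.smul_re, Complex.smul_im, smul_eq_mul]
      field_simp
      simp only [orient]
      ring

theorem orient_combo (a b x y : ℂ) (s t : ℝ) (hst : s + t = 1) :
    orient a b (s • x + t • y) = s * orient a b x + t * orient a b y := by
  simp only [orient, Complex.add_re, Complex.add_im, Complex.smul_re, Complex.smul_im, smul_eq_mul]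
  linear_combination ((b.re - a.re) * a.im - (b.im - a.im) * a.re) * hst

/-- The signed area is affine in its third point and vanishes on the line through `a` and `b`, while
`x` and `y` lie strictly on one side of it. -/
theorem disjoint_segment_of_orient_mul_pos {a b x y : ℂ}
    (h : 0 < orient a b x * orient a b y) : Disjoint (segment ℝ a b) (segment ℝ x y) := by
  rw [Set.disjoint_left]
  rintro _ ⟨s, t, hs, ht, hst, rfl⟩ ⟨s', t', hs', ht', hst', he⟩
  have h1 := orient_combo a b a b s t hst
  rw [← he, orient_combo a b x y s' t' hst'] at h1
  have h0 : orient a b a = 0 := by simp only [orient]; ring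
  have h0' : orient a b b = 0 := by simp only [orient]; ring
  rw [h0, h0', mul_zero, mul_zero, add_zero] at h1
  rcases pos_and_pos_or_neg_and_neg_of_mul_pos h with ⟨p, q⟩ | ⟨p, q⟩ <;>
    rcases hs'.eq_or_lt with h' | h' <;> nlinarith

theorem disjoint_segment {a x b y : Circle} (hab : Complex.arg a < Complex.arg b)
    (hxy : Complex.arg x < Complex.arg y)
    (hax : Complex.arg a ≠ Complex.arg x) (hay : Complex.arg a ≠ Complex.arg y)
    (hbx : Complex.arg b ≠ Complex.arg x) (hby : Complex.arg b ≠ Complex.arg y)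
    (h1 : ¬ (Complex.arg a < Complex.arg x ∧ Complex.arg x < Complex.arg b ∧
      Complex.arg b < Complex.arg y))
    (h2 : ¬ (Complex.arg x < Complex.arg a ∧ Complex.arg a < Complex.arg y ∧
      Complex.arg y < Complex.arg b)) :
    Disjoint (segment ℝ (a : ℂ) b) (segment ℝ (x : ℂ) y) := by
  have inside (z : Circle) (hz : Complex.arg a < Complex.arg z)
      (hz' : Complex.arg z < Complex.arg b) : orient a b z < 0 := by
    have := orient_pos hz hz'
    rw [orient_swap] at this
    linarith
  have outside (z : Circle) (hz : Complex.arg z < Complex.arg a ∨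
      Complex.arg b < Complex.arg z) : 0 < orient a b z := by
    rcases hz with hz | hz
    · have := orient_pos hz hab
      rwa [← orient_rotate] at this
    · exact orient_pos hab hz
  apply disjoint_segment_of_orient_mul_pos
  rcases lt_or_gt_of_ne hax with hx | hx <;> rcases lt_or_gt_of_ne hby with hy | hy
  · have hxb : Complex.arg b < Complex.arg x := by
      rcases lt_or_gt_of_ne hbx with h | h
      · exact h
      · exact absurd ⟨hx, h, hy⟩ h1
    exact mul_pos (outside x (.inr hxb)) (outside y (.inr hy))
  · exact mul_pos_of_neg_of_neg (inside x hx (hxy.trans hy)) (inside y (hx.trans hxy) hy)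
  · exact mul_pos (outside x (.inl hx)) (outside y (.inr hy))
  · have hya : Complex.arg y < Complex.arg a := by
      rcases lt_or_gt_of_ne hay with h | h
      · exact absurd ⟨hx, h, hy⟩ h2
      · exact h
    exact mul_pos (outside x (.inl hx)) (outside y (.inl hya))

theorem circle_arg_injective : Function.Injective fun z : Circle => Complex.arg z := by
  intro z w h
  exact Circle.ext (Complex.ext_norm_arg ((Circle.norm_coe z).trans (Circle.norm_coe w).symm) h)

/-- A straight-line drawing on the circle is plane iff no two edges interleave. -/
theorem drawing_iff_nonCrossing {V : Type*} (G : SimpleGraph V) (p : V → Circle)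
    (hp : Function.Injective p) :
    (∀ a b x y : V, G.Adj a b → G.Adj x y → a ≠ x → a ≠ y → b ≠ x → b ≠ y →
      Disjoint (segment ℝ (p a : ℂ) (p b : ℂ)) (segment ℝ (p x : ℂ) (p y : ℂ))) ↔
    NonCrossing G fun v => Complex.arg (p v) := by
  have inj : Function.Injective fun v => Complex.arg (p v) := circle_arg_injective.comp hp
  constructor
  · intro h a b x y hab hxy h1 h2 h3
    have ne {u v : V} (h : Complex.arg (p u) < Complex.arg (p v)) : u ≠ v := by
      rintro rfl; exact lt_irrefl _ h
    exact not_disjoint_segment h1 h2 h3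
      (h a b x y hab hxy (ne h1) (ne (h1.trans (h2.trans h3))) (ne h2).symm (ne h3))
  · intro h a b x y hab hxy ax ay bx bY
    wlog l1 : Complex.arg (p a) < Complex.arg (p b) generalizing a b
    · rw [segment_symm ℝ (p a : ℂ)]
      exact this b a hab.symm bx bY ax ay
        (lt_of_le_of_ne (not_lt.1 l1) (inj.ne hab.ne).symm)
    wlog l2 : Complex.arg (p x) < Complex.arg (p y) generalizing x y
    · rw [segment_symm ℝ (p x : ℂ)]
      exact this y x hxy.symm ay ax bY bx
        (lt_of_le_of_ne (not_lt.1 l2) (inj.ne hxy.ne).symm)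
    exact disjoint_segment l1 l2 (inj.ne ax) (inj.ne ay) (inj.ne bx) (inj.ne bY)
      (fun ⟨h1, h2, h3⟩ => h a b x y hab hxy h1 h2 h3)
      (fun ⟨h1, h2, h3⟩ => h x y a b hxy hab h1 h2 h3)

/-- A plane drawing on the circle numbers the vertices so that, for every graph, being drawn plane
means that no two edges interleave. -/
theorem exists_equiv_drawing_iff {V : Type*} [Fintype V] {n : ℕ} (hn : Fintype.card V = n)
    (p : V → Circle) (hp : Function.Injective p) :
    ∃ σ : V ≃ Fin n, ∀ G : SimpleGraph V,
      (∀ a b x y : V, G.Adj a b → G.Adj x y → a ≠ x → a ≠ y → b ≠ x → b ≠ y →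
        Disjoint (segment ℝ (p a : ℂ) (p b : ℂ)) (segment ℝ (p x : ℂ) (p y : ℂ))) ↔
      NonCrossing G σ := by
  have inj : Function.Injective fun v => Complex.arg (p v) := circle_arg_injective.comp hp
  let _ : LinearOrder V := LinearOrder.lift' _ inj
  let e : V ≃o Fin n := (Fintype.orderIsoFinOfCardEq V hn).symm
  refine ⟨e.toEquiv, fun G => ?_⟩
  rw [drawing_iff_nonCrossing G p hp]
  have key (u v : V) : e u < e v ↔ Complex.arg (p u) < Complex.arg (p v) := e.lt_iff_lt
  simp only [NonCrossing, RelIso.coe_fn_toEquiv, key]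

/-! ### Numberings and the outer cycle -/

/-- The cycle that visits the vertices in the cyclic order given by the numbering `σ`. -/
def cyclicGraph {V : Type*} {k : ℕ} (σ : V ≃ Fin (k + 3)) : SimpleGraph V :=
  (SimpleGraph.cycleGraph (k + 3)).comap σ

section Cyclic

variable {V : Type*} {k : ℕ}

theorem cyclicGraph_adj (σ : V ≃ Fin (k + 3)) {u v : V} :
    (cyclicGraph σ).Adj u v ↔ σ u = σ v + 1 ∨ σ v = σ u + 1 := by
  simp only [cyclicGraph, SimpleGraph.comap_adj, SimpleGraph.cycleGraph_adj, sub_eq_iff_eq_add,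
    add_comm (1 : Fin (k + 3))]

theorem fin_val_add_one (i : Fin (k + 3)) :
    (i + 1).val = if i.val = k + 2 then 0 else i.val + 1 := by
  rw [Fin.val_add_one]
  simp [Fin.ext_iff]

theorem fin_val_sub (i j : Fin (k + 3)) :
    (i - j).val = if j.val ≤ i.val then i.val - j.val else i.val + (k + 3) - j.val := by
  split_ifs with h
  · exact Fin.sub_val_of_le h
  · rw [Fin.coe_sub_iff_lt.2 (not_le.1 h)]; omega

theorem NonCrossing.mono {α : Type*} [LinearOrder α] {G H : SimpleGraph V} {r : V → α}
    (hH : NonCrossing H r) (h : G ≤ H) : NonCrossing G r :=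
  fun a b x y hab hxy => hH a b x y (h hab) (h hxy)

/-- A rotation turns an interleaving quadruple into one of its four cyclic shifts, and each of these
is excluded by `h`. A reflection, treated next, adds the four reversed orders. -/
theorem NonCrossing.sub_right {H : SimpleGraph V} {σ : V → Fin (k + 3)} (h : NonCrossing H σ)
    (c : Fin (k + 3)) : NonCrossing H fun v => σ v - c := by
  intro a b x y hab hxy h1 h2 h3
  have e1 := h a b x y hab hxy
  have e2 := h x y b a hxy hab.symm
  have e3 := h b a y x hab.symm hxy.symm
  have e4 := h y x a b hxy.symm hab
  rw [Fin.lt_def, fin_val_sub, fin_val_sub] at h1 h2 h3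
  simp only [Fin.lt_def] at e1 e2 e3 e4
  have := (σ a).isLt; have := (σ b).isLt; have := (σ x).isLt; have := (σ y).isLt
  have := c.isLt
  split_ifs at h1 h2 h3 <;> omega

theorem NonCrossing.sub_left {H : SimpleGraph V} {σ : V → Fin (k + 3)} (h : NonCrossing H σ)
    (c : Fin (k + 3)) : NonCrossing H fun v => c - σ v := by
  intro a b x y hab hxy h1 h2 h3
  have e1 := h a b x y hab hxy
  have e2 := h x y b a hxy hab.symm
  have e3 := h b a y x hab.symm hxy.symm
  have e4 := h y x a b hxy.symm hab
  have e5 := h y x b a hxy.symm hab.symm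
  have e6 := h b a x y hab.symm hxy
  have e7 := h x y a b hxy hab
  have e8 := h a b y x hab hxy.symm
  rw [Fin.lt_def, fin_val_sub, fin_val_sub] at h1 h2 h3
  simp only [Fin.lt_def] at e1 e2 e3 e4 e5 e6 e7 e8
  have := (σ a).isLt; have := (σ b).isLt; have := (σ x).isLt; have := (σ y).isLt
  have := c.isLt
  split_ifs at h1 h2 h3 <;> omega

theorem NonCrossing.sup_cyclicGraph {G : SimpleGraph V} {σ : V ≃ Fin (k + 3)}
    (h : NonCrossing G σ) : NonCrossing (G ⊔ cyclicGraph σ) σ := by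
  have key {u v : V} (huv : (cyclicGraph σ).Adj u v) :
      (σ u).val + 1 = σ v ∨ (σ v).val + 1 = σ u ∨ ((σ u).val = 0 ∧ (σ v).val = k + 2) ∨
        ((σ v).val = 0 ∧ (σ u).val = k + 2) := by
    rw [cyclicGraph_adj, Fin.ext_iff, Fin.ext_iff, fin_val_add_one, fin_val_add_one] at huv
    split_ifs at huv <;> omega
  intro a b x y hab hxy h1 h2 h3
  have ha := (σ a).isLt; have hb := (σ b).isLt; have hx := (σ x).isLt; have hy := (σ y).isLt
  rw [SimpleGraph.sup_adj] at hab hxy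
  rcases hab with hab | hab
  · rcases hxy with hxy | hxy
    · exact h a b x y hab hxy h1 h2 h3
    · have := key hxy
      simp only [Fin.lt_def] at h1 h2 h3
      omega
  · have := key hab
    simp only [Fin.lt_def] at h1 h2 h3
    omega

theorem IsBiconnected.mono [Fintype V] {G H : SimpleGraph V} (hG : IsBiconnected G) (h : G ≤ H) :
    IsBiconnected H where
  three_le_card := hG.three_le_card
  connected := hG.connected.mono h
  connected_delete v := (hG.connected_delete v).mono fun _ _ hab => h hab

/-- The numbering `σ` rotated so that the vertex numbered `c` gets number `0`. -/
def rotateNumbering (σ : V ≃ Fin (k + 3)) (c : Fin (k + 3)) : V ≃ Fin (k + 3) :=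
  σ.trans (Equiv.subRight c)

theorem rotateNumbering_apply (σ : V ≃ Fin (k + 3)) (c : Fin (k + 3)) (v : V) :
    rotateNumbering σ c v = σ v - c := rfl

theorem cyclicGraph_rotateNumbering (σ : V ≃ Fin (k + 3)) (c : Fin (k + 3)) :
    cyclicGraph (rotateNumbering σ c) = cyclicGraph σ := by
  ext u v
  simp only [cyclicGraph, SimpleGraph.comap_adj, SimpleGraph.cycleGraph_adj,
    rotateNumbering_apply, sub_sub_sub_cancel_right]

theorem isBiconnected_cyclicGraph [Fintype V] (σ : V ≃ Fin (k + 3)) :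
    IsBiconnected (cyclicGraph σ) where
  three_le_card := by rw [Fintype.card_congr σ, Fintype.card_fin]; omega
  connected := by
    rw [cyclicGraph, (SimpleGraph.Iso.comap σ _).connected_iff]
    exact SimpleGraph.cycleGraph_connected
  connected_delete v := by
    -- With the deleted vertex at 0, the others form the path 1, ..., k + 2.
    let τ := rotateNumbering σ (σ v)
    have hτ : τ v = 0 := sub_self _
    rw [← cyclicGraph_rotateNumbering σ (σ v)]
    change ((cyclicGraph τ).induce {v}ᶜ).Connected
    have ne {i : Fin (k + 3)} (hi : i.val ≠ 0) : τ.symm i ∈ ({v}ᶜ : Set V) := by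
      intro h
      apply hi
      rw [← τ.apply_symm_apply i, (Set.mem_singleton_iff.1 h : τ.symm i = v), hτ]
      rfl
    have reach : ∀ (j : ℕ) (hj : j + 1 < k + 3),
        ((cyclicGraph τ).induce {v}ᶜ).Reachable
          ⟨τ.symm ⟨0 + 1, by omega⟩, ne (Nat.succ_ne_zero 0)⟩
          ⟨τ.symm ⟨j + 1, hj⟩, ne (Nat.succ_ne_zero j)⟩ := by
      intro j
      induction j with
      | zero => exact fun _ => SimpleGraph.Reachable.refl _
      | succ j ih =>
        intro hj
        refine (ih (by omega)).trans (SimpleGraph.Adj.reachable ?_)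
        simp only [SimpleGraph.induce_adj, cyclicGraph_adj, Equiv.apply_symm_apply]
        right
        rw [Fin.ext_iff, fin_val_add_one]
        simp only
        split_ifs <;> omega
    rw [SimpleGraph.connected_iff_exists_forall_reachable]
    refine ⟨⟨τ.symm ⟨0 + 1, by omega⟩, ne (Nat.succ_ne_zero 0)⟩, fun ⟨w, hw⟩ => ?_⟩
    have hw0 : (τ w).val ≠ 0 := by
      intro h
      exact hw (τ.injective (by rw [hτ]; exact Fin.ext h))
    have := reach ((τ w).val - 1) (by have := (τ w).isLt; omega)
    convert this
    rw [Equiv.eq_symm_apply, Fin.ext_iff]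
    simp only
    omega

/-- A biconnected graph without interleaving edges joins the first to the last vertex. -/
theorem NonCrossing.adj_of_zero_of_last [Fintype V] {H : SimpleGraph V} {σ : V ≃ Fin (k + 3)}
    (hH : IsBiconnected H) (h : NonCrossing H σ) {u v : V} (hv : (σ v).val = 0)
    (hu : (σ u).val = k + 2) : H.Adj v u := by
  classical
  by_contra hvu
  have hne : v ≠ u := by rintro rfl; omega
  have : Nontrivial V := ⟨v, u, hne⟩
  obtain ⟨w, hw⟩ := hH.connected.preconnected.exists_adj_of_nontrivial v
  -- `m` is the farthest neighbour of `v`. A walk to `u` avoiding `m` must jump over `m`: from `v`,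
  -- against maximality, or from a vertex strictly between, crossing the edge `v m`.
  obtain ⟨m, hm, hmax⟩ := (Finset.univ.filter fun w => H.Adj v w).exists_max_image σ
    ⟨w, by simpa using hw⟩
  simp only [Finset.mem_filter, Finset.mem_univ, true_and] at hm hmax
  have hmv : σ v < σ m := by
    rw [Fin.lt_def, hv]
    have : σ m ≠ σ v := σ.injective.ne hm.ne'
    rw [Ne, Fin.ext_iff] at this
    omega
  have hmu : σ m < σ u := by
    have hmu : m ≠ u := by rintro rfl; exact hvu hm
    have : σ m ≠ σ u := σ.injective.ne hmu
    rw [Ne, Fin.ext_iff] at this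
    have := (σ m).isLt
    rw [Fin.lt_def]
    omega
  have mv : v ∈ ({m}ᶜ : Set V) := by rintro rfl; exact lt_irrefl _ hmv
  have mu : u ∈ ({m}ᶜ : Set V) := by rintro rfl; exact lt_irrefl _ hmu
  obtain ⟨q⟩ := (hH.connected_delete m).preconnected ⟨v, mv⟩ ⟨u, mu⟩
  obtain ⟨d, -, hd1, hd2⟩ := q.exists_boundary_dart {z | σ z.1 < σ m} hmv (not_lt.2 hmu.le)
  have hadj : H.Adj d.fst.1 d.snd.1 := d.adj
  have hd2' : σ m < σ d.snd.1 :=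
    lt_of_le_of_ne (not_lt.1 hd2) (fun he => d.snd.2 (σ.injective he).symm)
  rcases eq_or_ne d.fst.1 v with hd | hd
  · rw [hd] at hadj
    exact absurd (hmax _ hadj) (not_le.2 hd2')
  · refine h v m d.fst d.snd hm hadj ?_ hd1 hd2'
    have : σ d.fst.1 ≠ σ v := σ.injective.ne hd
    rw [Ne, Fin.ext_iff] at this
    rw [Fin.lt_def]
    omega

/-- A biconnected graph without interleaving edges contains the outer cycle. -/
theorem NonCrossing.cyclicGraph_le [Fintype V] {H : SimpleGraph V} {σ : V ≃ Fin (k + 3)}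
    (hH : IsBiconnected H) (h : NonCrossing H σ) : cyclicGraph σ ≤ H := by
  have key (u v : V) (huv : σ v = σ u + 1) : H.Adj v u := by
    have hrot : NonCrossing H (rotateNumbering σ (σ v)) := h.sub_right _
    refine hrot.adj_of_zero_of_last hH ?_ ?_
    · rw [rotateNumbering_apply, sub_self]; rfl
    · rw [rotateNumbering_apply, huv, sub_add_cancel_left, Fin.val_neg]
      simp
  intro u v huv
  rw [cyclicGraph_adj] at huv
  rcases huv with huv | huv
  · exact key v u huv
  · exact (key u v huv).symm

theorem fin_one_add_one_ne_zero : (1 + 1 : Fin (k + 3)) ≠ 0 := by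
  intro h
  have := congrArg Fin.val h
  rw [fin_val_add_one] at this
  simp at this

/-- Two numberings are rotations or reflections of each other if consecutive vertices of the first
are consecutive in the second. -/
theorem eq_add_or_eq_sub_of_cyclicGraph_le {σ τ : V ≃ Fin (k + 3)}
    (h : cyclicGraph σ ≤ cyclicGraph τ) :
    (∃ c, ∀ v, τ v = σ v - c) ∨ ∃ c, ∀ v, τ v = c - σ v := by
  let g : Fin (k + 3) → Fin (k + 3) := fun i => τ (σ.symm i)
  have hg : Function.Injective g := τ.injective.comp σ.symm.injective
  have step (i : Fin (k + 3)) : g (i + 1) = g i + 1 ∨ g (i + 1) = g i - 1 := by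
    have : (cyclicGraph τ).Adj (σ.symm (i + 1)) (σ.symm i) :=
      h ((cyclicGraph_adj σ).2 (.inl (by simp)))
    rw [cyclicGraph_adj] at this
    rcases this with h | h
    · exact .inl h
    · exact .inr (eq_sub_of_add_eq h.symm)
  have back (i : Fin (k + 3)) : g (i + 1 + 1) ≠ g i := by
    intro he
    have := hg he
    rw [add_assoc, add_eq_left] at this
    exact fin_one_add_one_ne_zero this
  have nat (P : Fin (k + 3) → Prop) (h0 : P 0) (hs : ∀ i, P i → P (i + 1)) (i : Fin (k + 3)) :
      P i := by
    obtain ⟨j, hj⟩ := i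
    induction j with
    | zero => exact h0
    | succ j ih =>
      have := hs _ (ih (by omega))
      convert this
      rw [fin_val_add_one]
      simp only
      split_ifs <;> omega
  -- The direction of the first step persists, since turning back would repeat a value two places
  -- later.
  rcases step 0 with h0 | h0
  · have up : ∀ i, g (i + 1) = g i + 1 := by
      refine nat _ h0 fun i hi => ?_
      rcases step (i + 1) with h1 | h1
      · exact h1
      · exact absurd (by rw [h1, hi, add_sub_cancel_right]) (back i)
    have val : ∀ i, g i = i - -g 0 := by
      refine nat _ (by simp) fun i hi => ?_
      rw [up, hi]; abel
    exact .inl ⟨-g 0, fun v => by rw [← val]; simp [g]⟩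
  · have down : ∀ i, g (i + 1) = g i - 1 := by
      refine nat _ h0 fun i hi => ?_
      rcases step (i + 1) with h1 | h1
      · exact absurd (by rw [h1, hi, sub_add_cancel]) (back i)
      · exact h1
    have val : ∀ i, g i = g 0 - i := by
      refine nat _ (by simp) fun i hi => ?_
      rw [down, hi]; abel
    exact .inr ⟨g 0, fun v => by rw [← val]; simp [g]⟩

/-- The only Hamiltonian cycle of a biconnected graph without interleaving edges is the outer
cycle, and no edges interleave along it. -/
theorem NonCrossing.of_cyclicGraph_le [Fintype V] {H : SimpleGraph V} {σ τ : V ≃ Fin (k + 3)}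
    (h : NonCrossing H σ) (hτ : cyclicGraph τ ≤ H) :
    cyclicGraph τ = cyclicGraph σ ∧ NonCrossing H τ := by
  -- `cyclicGraph τ` plays the role of the biconnected graph here, so it contains `cyclicGraph σ`.
  rcases eq_add_or_eq_sub_of_cyclicGraph_le
    ((h.mono hτ).cyclicGraph_le (isBiconnected_cyclicGraph τ)) with ⟨c, hc⟩ | ⟨c, hc⟩
  · refine ⟨?_, ?_⟩
    · ext u v
      simp only [cyclicGraph, SimpleGraph.comap_adj, SimpleGraph.cycleGraph_adj, hc,
        sub_sub_sub_cancel_right]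
    · have : (τ : V → Fin (k + 3)) = fun v => σ v - c := funext hc
      rw [this]
      exact h.sub_right c
  · refine ⟨?_, ?_⟩
    · ext u v
      simp only [cyclicGraph, SimpleGraph.comap_adj, SimpleGraph.cycleGraph_adj, hc,
        sub_sub_sub_cancel_left]
      exact or_comm
    · have : (τ : V → Fin (k + 3)) = fun v => c - σ v := funext hc
      rw [this]
      exact h.sub_left c

end Cyclic

/-! ### Hamiltonian cycles as numberings -/

section Hamiltonian

variable {V : Type*} [Fintype V] [DecidableEq V] {k : ℕ}

theorem exists_isHamiltonianCycle_of_cyclicGraph_le {H : SimpleGraph V} {σ : V ≃ Fin (k + 3)}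
    (h : cyclicGraph σ ≤ H) (t : V) : ∃ p : H.Walk t t, p.IsHamiltonianCycle := by
  have : Nontrivial V := σ.nontrivial
  refine SimpleGraph.IsHamiltonian.exists_isHamiltonianCycle (fun _ => ?_) t
  let f : SimpleGraph.cycleGraph (k + 3) →g H :=
    (SimpleGraph.Hom.ofLE h).comp (SimpleGraph.Iso.comap σ _).symm.toHom
  have hf : Function.Bijective f := σ.symm.bijective
  refine ⟨_, (SimpleGraph.cycleGraph.cycle k).map f, SimpleGraph.Walk.IsHamiltonianCycle.map hf ?_⟩
  rw [SimpleGraph.Walk.isHamiltonianCycle_iff_isCycle_and_length_eq]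
  exact ⟨SimpleGraph.cycleGraph.isCycle_cycle, by simp⟩

/-- A Hamiltonian cycle numbers the vertices by their position on it. -/
theorem exists_equiv_tourPosition (hk : Fintype.card V = k + 3) {H : SimpleGraph V} {t : V}
    {p : H.Walk t t} (hp : p.IsHamiltonianCycle) :
    ∃ τ : V ≃ Fin (k + 3), (∀ v, (τ v).val = tourPosition p v) ∧
      ∀ u v, s(u, v) ∈ p.edges ↔ (cyclicGraph τ).Adj u v := by
  have hl : p.length = k + 3 := hp.length_eq.trans hk
  have hget (v : V) : p.getVert (tourPosition p v) = v :=
    p.getVert_support_idxOf (hp.mem_support v)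
  have hlt (v : V) : tourPosition p v < k + 3 := by
    have h1 : tourPosition p v < p.support.length := List.idxOf_lt_length_iff.2 (hp.mem_support v)
    rw [SimpleGraph.Walk.length_support] at h1
    -- The support lists `t` at both ends; `idxOf` takes the first occurrence, so the last index is
    -- never attained.
    rcases Nat.lt_succ_iff_lt_or_eq.1 h1 with h2 | h2
    · omega
    · have hv : v = t := by
        rw [← hget v, h2, p.getVert_length]
      have h0 : tourPosition p v = 0 := by
        rw [hv, tourPosition, ← p.cons_tail_support, List.idxOf_cons_self]
      omega
  let f : V → Fin (k + 3) := fun v => ⟨tourPosition p v, hlt v⟩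
  have hf : Function.Injective f := by
    intro u v huv
    have : tourPosition p u = tourPosition p v := congrArg Fin.val huv
    rw [← hget u, this, hget]
  let τ : V ≃ Fin (k + 3) := Equiv.ofBijective f
    ((Fintype.bijective_iff_injective_and_card f).2 ⟨hf, by simpa using hk⟩)
  have hval (v : V) : (τ v).val = tourPosition p v := rfl
  have hτ (v : V) : p.getVert (τ v) = v := hget v
  have hpos (i : ℕ) (hi : i < k + 3) : (τ (p.getVert i)).val = i := by
    refine hp.isCycle.getVert_injOn' ?_ ?_ (hτ _)
    · have := (τ (p.getVert i)).isLt
      simp only [Set.mem_ofPred_eq]; omega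
    · simp only [Set.mem_ofPred_eq]; omega
  have hlast : p.getVert (k + 3) = t := p.getVert_of_length_le hl.le
  have hend : (τ (p.getVert (k + 3))).val = 0 := by
    rw [hlast]
    have h := hpos 0 (by omega)
    rwa [p.getVert_zero] at h
  refine ⟨τ, hval, fun u v => ?_⟩
  rw [← p.adj_toSubgraph_iff_mem_edges, p.toSubgraph_adj_iff]
  have key (i : ℕ) (hi : i < k + 3) : τ (p.getVert (i + 1)) = τ (p.getVert i) + 1 := by
    rw [Fin.ext_iff, fin_val_add_one, hpos i hi]
    split_ifs with h
    · rw [h, hend]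
    · exact hpos _ (by omega)
  have key' (u v : V) (h : τ v = τ u + 1) : s(p.getVert (τ u), p.getVert (τ u + 1)) = s(u, v) := by
    rw [hτ]
    congr 1
    apply τ.injective
    rw [key _ (τ u).isLt, hτ, h]
  constructor
  · rintro ⟨i, he, hi⟩
    rw [cyclicGraph_adj]
    have := key i (hi.trans_eq hl)
    rcases Sym2.eq_iff.1 he with ⟨rfl, rfl⟩ | ⟨rfl, rfl⟩
    · exact .inr this
    · exact .inl this
  · intro h
    rcases (cyclicGraph_adj τ).1 h with h | h
    · exact ⟨τ v, by rw [key' v u h, Sym2.eq_swap], (τ v).isLt.trans_eq hl.symm⟩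
    · exact ⟨τ u, key' u v h, (τ u).isLt.trans_eq hl.symm⟩

end Hamiltonian

/-! ### Non-interleaving components of forests -/

section Separation

variable {V α : Type*} [LinearOrder α]

/-- A walk from `c` can leave the interval below the edge `u v` only by crossing that edge or by
meeting `u` or `v`, which lie in another component. -/
theorem NonCrossing.between_of_reachable {K : SimpleGraph V} {r : V → α}
    (hr : Function.Injective r) (hK : NonCrossing K r) {u v c d : V} (huv : K.Adj u v)
    (hcd : K.Reachable c d) (huc : ¬ K.Reachable u c) (h1 : r u < r c) (h2 : r c < r v) :
    r u < r d ∧ r d < r v := by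
  classical
  by_contra hd
  obtain ⟨p⟩ := hcd
  obtain ⟨e, he, ⟨e1, e2⟩, e3⟩ := p.exists_boundary_dart {z | r u < r z ∧ r z < r v} ⟨h1, h2⟩ hd
  have hce : K.Reachable c e.snd := ⟨p.takeUntil _ (p.dart_snd_mem_support_of_mem_darts he)⟩
  have hu : r e.snd ≠ r u := hr.ne (by intro h; exact huc (h ▸ hce.symm))
  have hv : r e.snd ≠ r v := hr.ne (by intro h; exact huc (huv.reachable.trans (h ▸ hce.symm)))
  by_cases h : r u < r e.snd
  · exact hK u v _ _ huv e.adj e1 e2 (lt_of_le_of_ne (not_lt.1 fun h' => e3 ⟨h, h'⟩) hv.symm)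
  · exact hK _ _ u v e.adj.symm huv (lt_of_le_of_ne (not_lt.1 h) hu) e1 e2

/-- Different connected components of a graph without interleaving edges do not interleave. -/
theorem NonCrossing.reachable_of_interleave {K : SimpleGraph V} {r : V → α}
    (hr : Function.Injective r) (hK : NonCrossing K r) {a b x y : V} (hab : K.Reachable a b)
    (hxy : K.Reachable x y) (h1 : r a < r x) (h2 : r x < r b) (h3 : r b < r y) :
    K.Reachable a x := by
  classical
  by_contra hax
  obtain ⟨q⟩ := hxy
  -- A single edge of the walk already leaves the interval, so it separates `a` from `b` in the
  -- order, and `between_of_reachable` applies to it.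
  obtain ⟨e, he, ⟨e1, e2⟩, e3⟩ := q.exists_boundary_dart {z | r a < r z ∧ r z < r b} ⟨h1, h2⟩
    (fun h => lt_asymm h3 h.2)
  have hxe : K.Reachable x e.fst := ⟨q.takeUntil _ (q.dart_fst_mem_support_of_mem_darts he)⟩
  have hxe' : K.Reachable x e.snd := ⟨q.takeUntil _ (q.dart_snd_mem_support_of_mem_darts he)⟩
  have ha : ¬ K.Reachable e.snd a := fun h => hax (hxe'.trans h).symm
  have hb : ¬ K.Reachable e.fst b := fun h => hax (hab.trans (hxe.trans h).symm)
  have na : r e.snd ≠ r a := hr.ne (by intro h; exact ha (h ▸ .refl _))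
  have nb : r e.snd ≠ r b := hr.ne (by
    intro h; exact hb (e.adj.reachable.trans (h ▸ .refl _)))
  by_cases h : r a < r e.snd
  · have h' : r b < r e.snd := lt_of_le_of_ne (not_lt.1 fun h' => e3 ⟨h, h'⟩) nb.symm
    exact lt_asymm e1 (hK.between_of_reachable hr e.adj hab.symm hb e2 h').1
  · have h' : r e.snd < r a := lt_of_le_of_ne (not_lt.1 h) na
    exact lt_asymm e2 (hK.between_of_reachable hr e.adj.symm hab ha h' e1).2

theorem reachable_deleteEdges_or {T : SimpleGraph V} {x y z : V} (h : T.Reachable x z) :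
    (T.deleteEdges {s(x, y)}).Reachable x z ∨ (T.deleteEdges {s(x, y)}).Reachable y z := by
  by_contra! hz
  obtain ⟨p⟩ := h
  obtain ⟨e, -, e1, e2⟩ := p.exists_boundary_dart
    {z | (T.deleteEdges {s(x, y)}).Reachable x z ∨ (T.deleteEdges {s(x, y)}).Reachable y z}
    (.inl (.refl _)) (not_or.2 hz)
  by_cases he : s(e.fst, e.snd) = s(x, y)
  · rcases Sym2.eq_iff.1 he with ⟨-, h⟩ | ⟨-, h⟩
    · exact e2 (.inr (h ▸ .refl _))
    · exact e2 (.inl (h ▸ .refl _))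
  · have : (T.deleteEdges {s(x, y)}).Adj e.fst e.snd :=
      SimpleGraph.deleteEdges_adj.2 ⟨e.adj, he⟩
    exact e2 (e1.imp (·.trans this.reachable) (·.trans this.reachable))

/-- Paths in a forest are unique, so no walk can avoid `e`. -/
theorem not_reachable_deleteEdges {T : SimpleGraph V} (hT : T.IsAcyclic) {u v : V} {e : Sym2 V}
    (q : T.Path u v) (he : e ∈ q.1.edges) : ¬ (T.deleteEdges {e}).Reachable u v := by
  classical
  rintro ⟨w⟩
  let w' : T.Path u v := ⟨w.bypass.mapLe (T.deleteEdges_le {e}), w.bypass_isPath.mapLe _⟩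
  rw [(hT.subsingleton_path u v).elim q w'] at he
  simp only [w', SimpleGraph.Walk.edges_mapLe_eq_edges] at he
  have := w.bypass.edges_subset_edgeSet he
  simp at this

variable [DecidableEq V]

/-- In a forest without interleaving edges, every edge lies on at most two of the paths that join
each vertex of a set to its predecessor. -/
theorem NonCrossing.card_filter_mem_edges_le_two {T : SimpleGraph V} {r : V → α}
    (hr : Function.Injective r) (hT : NonCrossing T r) (hT' : T.IsAcyclic) {S : Finset V}
    {pred : S → V} (h1 : ∀ i : S, r (pred i) < r i)
    (h2 : ∀ i j : S, r i < r j → r i ≤ r (pred j)) (q : (i : S) → T.Path (pred i) i)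
    (e : Sym2 V) : (Finset.univ.filter fun i : S => e ∈ (q i).1.edges).card ≤ 2 := by
  classical
  induction e with | h x y =>
  let K := T.deleteEdges {s(x, y)}
  have hK : NonCrossing K r := hT.mono (T.deleteEdges_le _)
  have sep {i : S} (hi : s(x, y) ∈ (q i).1.edges) : ¬ K.Reachable (pred i) i :=
    not_reachable_deleteEdges hT' _ hi
  have tgt {i : S} (hi : s(x, y) ∈ (q i).1.edges) : K.Reachable x i ∨ K.Reachable y i :=
    reachable_deleteEdges_or
      ⟨(q i).1.dropUntil x ((q i).1.fst_mem_support_of_mem_edges hi)⟩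
  have src {i : S} (hi : s(x, y) ∈ (q i).1.edges) :
      K.Reachable x (pred i) ∨ K.Reachable y (pred i) :=
    reachable_deleteEdges_or
      ⟨((q i).1.takeUntil x ((q i).1.fst_mem_support_of_mem_edges hi)).reverse⟩
  have one (z w : V) : (Finset.univ.filter fun i : S => s(x, y) ∈ (q i).1.edges ∧
      K.Reachable z (pred i) ∧ K.Reachable w i).card ≤ 1 := by
    rw [Finset.card_le_one]
    intro i hi j hj
    simp only [Finset.mem_filter, Finset.mem_univ, true_and] at hi hj
    by_contra hij
    wlog hlt : r i < r j generalizing i j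
    · exact this j i hj hi (Ne.symm hij)
        (lt_of_le_of_ne (not_lt.1 hlt) (hr.ne fun h => hij (Subtype.ext h.symm)))
    have hne : r i ≠ r (pred j) := hr.ne (by
      intro h
      exact sep hi.1 (hi.2.1.symm.trans (hj.2.1.trans (h ▸ .refl _))))
    -- The order is `pred i`, `i`, `pred j`, `j`, with alternating components.
    exact sep hi.1 (hK.reachable_of_interleave hr (hi.2.1.symm.trans hj.2.1)
      (hi.2.2.symm.trans hj.2.2) (h1 i) (lt_of_le_of_ne (h2 i j hlt) hne) (h1 j))
  refine (Finset.card_le_card ?_).trans ((Finset.card_union_le _ _).trans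
    (add_le_add (one x y) (one y x)))
  intro i hi
  simp only [Finset.mem_filter, Finset.mem_univ, true_and, Finset.mem_union] at hi ⊢
  rcases src hi with hs | hs <;> rcases tgt hi with ht | ht
  · exact absurd (hs.symm.trans ht) (sep hi)
  · exact .inl ⟨hi, hs, ht⟩
  · exact .inr ⟨hi, hs, ht⟩
  · exact absurd (hs.symm.trans ht) (sep hi)

end Separation

/-! ### Equilibria of ordered protocols -/

section Game

variable {V : Type*} [DecidableEq V] {G : SimpleGraph V} {t : V} {S : Finset V}
  {c : Sym2 V → ℝ≥0} {π : V → ℕ}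

theorem mem_users {P : Outcome G t S} {e : Sym2 V} {j : V} :
    j ∈ users P e ↔ ∃ h : j ∈ S, e ∈ pathEdges (P ⟨j, h⟩) := by
  simp [users]

theorem orderedProtocol_le (e : Sym2 V) (i : V) (R : Finset V) :
    orderedProtocol c π e i R ≤ c e := by
  unfold orderedProtocol
  split_ifs
  · exact le_rfl
  · exact zero_le

/-- A player's cost depends only on the paths of the players up to her in the order. -/
theorem playerCost_congr {P P' : Outcome G t S} {i : S}
    (h : ∀ j : S, π j ≤ π i → P j = P' j) :
    playerCost (orderedProtocol c π) P i = playerCost (orderedProtocol c π) P' i := by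
  have key {P P' : Outcome G t S} (h : ∀ j : S, π j ≤ π i → P j = P' j) {e : Sym2 V}
      (he : (i : V) ∈ users P e ∧ ∀ j ∈ users P e, π i ≤ π j) :
      (i : V) ∈ users P' e ∧ ∀ j ∈ users P' e, π i ≤ π j := by
    refine ⟨?_, fun j hj => ?_⟩
    · obtain ⟨hi, hi'⟩ := mem_users.1 he.1
      exact mem_users.2 ⟨hi, h i le_rfl ▸ hi'⟩
    · by_contra hlt
      obtain ⟨hjS, hj'⟩ := mem_users.1 hj
      exact hlt (he.2 j (mem_users.2 ⟨hjS, (h ⟨j, hjS⟩ (le_of_not_ge hlt)).symm ▸ hj'⟩))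
  unfold playerCost
  rw [h i le_rfl]
  refine Finset.sum_congr rfl fun e _ => ?_
  unfold orderedProtocol
  exact if_congr ⟨key h, key fun j hj => (h j hj).symm⟩ rfl rfl

theorem exists_isNash [Finite V] (hG : G.Connected) (c : Sym2 V → ℝ≥0)
    (hπ : Function.Injective π) : ∃ P : Outcome G t S, IsNash (orderedProtocol c π) P := by
  classical
  have := Fintype.ofFinite V
  -- The players before position `m` already play best responses; by `playerCost_congr`, later
  -- choices do not disturb them.
  have step (m : ℕ) : ∃ P : Outcome G t S, ∀ i : S, π i < m → ∀ Q : G.Path (i : V) t,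
      playerCost (orderedProtocol c π) P i ≤
        playerCost (orderedProtocol c π) (Function.update P i Q) i := by
    induction m with
    | zero =>
      exact ⟨fun i => (Nonempty.some (hG.preconnected i t)).toPath, fun i hi => absurd hi (Nat.not_lt_zero _)⟩
    | succ m ih =>
      obtain ⟨P, hP⟩ := ih
      by_cases hm : ∃ i : S, π i = m
      · obtain ⟨i, hi⟩ := hm
        have : Nonempty (G.Path (i : V) t) := ⟨P i⟩
        obtain ⟨Q, hQ⟩ := Finite.exists_min fun Q : G.Path (i : V) t =>
          playerCost (orderedProtocol c π) (Function.update P i Q) i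
        refine ⟨Function.update P i Q, fun j hj Q' => ?_⟩
        rcases Nat.lt_succ_iff_lt_or_eq.1 hj with hj | hj
        · have ne {l : S} (hl : π l ≤ π j) : l ≠ i := by
            rintro rfl; omega
          refine (playerCost_congr fun l hl => Function.update_of_ne (ne hl) _ _).trans_le
            ((hP j hj Q').trans_eq (playerCost_congr fun l hl => ?_))
          rw [Function.update_comm (ne le_rfl).symm, Function.update_of_ne (ne hl)]
        · obtain rfl : j = i := Subtype.ext (hπ (hj.trans hi.symm))
          rw [Function.update_idem]
          exact hQ Q'
      · refine ⟨P, fun i hi => hP i ?_⟩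
        rcases Nat.lt_succ_iff_lt_or_eq.1 hi with h | h
        · exact h
        · exact absurd ⟨i, h⟩ hm
  obtain ⟨P, hP⟩ := step ((Finset.univ.sup fun i : S => π i) + 1)
  exact ⟨P, fun i => hP i (Nat.lt_succ_of_le (Finset.le_sup (f := fun i : S => π i)
    (Finset.mem_univ i)))⟩

/-- The shares of the ordered protocol cover the cost of the outcome. -/
theorem outcomeCost_le_sum_playerCost (P : Outcome G t S) :
    outcomeCost c P ≤ ∑ i : S, playerCost (orderedProtocol c π) P i := by
  classical
  unfold outcomeCost playerCost
  rw [Finset.sum_comm' (t' := Finset.univ.biUnion fun i : S => pathEdges (P i))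
    (s' := fun e => Finset.univ.filter fun i : S => e ∈ pathEdges (P i))
    (by intro i e; simp only [Finset.mem_univ, true_and, Finset.mem_filter, Finset.mem_biUnion]
        exact ⟨fun h => ⟨h, i, h⟩, fun h => h.1⟩)]
  refine Finset.sum_le_sum fun e he => ?_
  obtain ⟨i₀, -, hi₀⟩ := Finset.mem_biUnion.1 he
  obtain ⟨i, hi, hmin⟩ := (Finset.univ.filter fun i : S => e ∈ pathEdges (P i)).exists_min_image
    (fun i => π i) ⟨i₀, by simpa using hi₀⟩
  refine le_trans (le_of_eq ?_) (Finset.single_le_sum (fun _ _ => zero_le) hi)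
  unfold orderedProtocol
  rw [if_pos]
  simp only [Finset.mem_filter, Finset.mem_univ, true_and] at hi hmin
  refine ⟨mem_users.2 ⟨i.2, hi⟩, fun j hj => ?_⟩
  obtain ⟨hjS, hj⟩ := mem_users.1 hj
  exact hmin ⟨j, hjS⟩ hj

/-- A player can join an earlier player, or the root, and use the rest of her path for free. -/
theorem IsNash.playerCost_le {P : Outcome G t S} (hP : IsNash (orderedProtocol c π) P) {i : S}
    {j : V} (hj : j = t ∨ j ∈ S ∧ π j < π i) (q : G.Walk j i) :
    playerCost (orderedProtocol c π) P i ≤ ∑ e ∈ q.edges.toFinset, c e := by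
  -- On `w`, the path of `j`, the charge to `i` is zero whatever path she picks, because `j` uses
  -- these edges and precedes her.
  obtain ⟨w, hw⟩ : ∃ w : G.Walk j t, ∀ Q : G.Path (i : V) t, ∀ e ∈ w.edges,
      orderedProtocol c π e i (users (Function.update P i Q) e) = 0 := by
    rcases hj with rfl | ⟨hjS, hji⟩
    · exact ⟨.nil, by simp⟩
    · refine ⟨(P ⟨j, hjS⟩).1, fun Q e he => if_neg fun h => ?_⟩
      have hne : (⟨j, hjS⟩ : S) ≠ i := by rintro rfl; exact lt_irrefl _ hji
      refine absurd (h.2 j (mem_users.2 ⟨hjS, ?_⟩)) (not_le.2 hji)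
      rw [Function.update_of_ne hne]
      exact List.mem_toFinset.2 he
  let Q : G.Path (i : V) t := (q.reverse.append w).toPath
  refine (hP i Q).trans ?_
  unfold playerCost
  rw [Function.update_self]
  have hsub : pathEdges Q ⊆ q.edges.toFinset ∪ w.edges.toFinset := by
    intro e he
    have := (q.reverse.append w).edges_toPath_subset_edges (List.mem_toFinset.1 he)
    simpa [SimpleGraph.Walk.edges_append] using this
  refine (Finset.sum_le_sum_of_subset hsub).trans ?_
  calc ∑ e ∈ q.edges.toFinset ∪ w.edges.toFinset,
        orderedProtocol c π e i (users (Function.update P i Q) e)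
      ≤ ∑ e ∈ q.edges.toFinset, orderedProtocol c π e i (users (Function.update P i Q) e) +
        ∑ e ∈ w.edges.toFinset, orderedProtocol c π e i (users (Function.update P i Q) e) := by
        rw [← Finset.sum_union_inter]; exact le_self_add
    _ = ∑ e ∈ q.edges.toFinset, orderedProtocol c π e i (users (Function.update P i Q) e) := by
        rw [Finset.sum_eq_zero fun e he => hw Q e (List.mem_toFinset.1 he), add_zero]
    _ ≤ ∑ e ∈ q.edges.toFinset, c e := Finset.sum_le_sum fun e _ => orderedProtocol_le _ _ _

theorem IsNash.outcomeCost_le (hG : NonCrossing G π) (hπ : Function.Injective π) (h0 : π t = 0)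
    (hS : t ∉ S) {P : Outcome G t S} (hP : IsNash (orderedProtocol c π) P) (P' : Outcome G t S) :
    outcomeCost c P ≤ 2 * outcomeCost c P' := by
  classical
  let U : Finset (Sym2 V) := Finset.univ.biUnion fun i : S => pathEdges (P' i)
  have mem_U {e : Sym2 V} {i : S} (he : e ∈ (P' i).1.edges) : e ∈ U :=
    Finset.mem_biUnion.2 ⟨i, Finset.mem_univ _, List.mem_toFinset.2 he⟩
  let F : SimpleGraph V := SimpleGraph.fromEdgeSet U
  have hFG : F ≤ G := by
    intro u v huv
    obtain ⟨i, -, hi⟩ := Finset.mem_biUnion.1 ((SimpleGraph.fromEdgeSet_adj _).1 huv).1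
    exact (P' i).1.adj_of_mem_edges (List.mem_toFinset.1 hi)
  have hF (i : S) : F.Reachable i t :=
    ⟨(P' i).1.transfer F fun e he => by
      rw [SimpleGraph.edgeSet_fromEdgeSet]
      exact ⟨mem_U he, G.not_isDiag_of_mem_edgeSet ((P' i).1.edges_subset_edgeSet he)⟩⟩
  -- The union of the paths of `P'` may contain cycles; the count of connecting paths per edge needs
  -- a forest.
  obtain ⟨T, hTF, hT, hTr⟩ := F.exists_isAcyclic_reachable_eq_le
  have hpred (i : S) : ∃ j, (j = t ∨ j ∈ S ∧ π j < π i) ∧ π j < π i ∧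
      ∀ l ∈ S, π l < π i → π l ≤ π j := by
    have hti : π t < π i := by
      have : π i ≠ π t := hπ.ne fun h => hS (h ▸ i.2)
      omega
    obtain ⟨j, hj, hmax⟩ := ((insert t S).filter fun j => π j < π i).exists_max_image π
      ⟨t, by simpa using hti⟩
    simp only [Finset.mem_filter, Finset.mem_insert] at hj hmax
    exact ⟨j, hj.1.imp_right fun h => ⟨h, hj.2⟩, hj.2, fun l hl hli => hmax l ⟨.inr hl, hli⟩⟩
  choose pred hp1 hp2 hp3 using hpred
  have hq (i : S) : T.Reachable (pred i) i := by
    rw [hTr]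
    refine SimpleGraph.Reachable.trans ?_ (hF i).symm
    rcases hp1 i with h | h
    · rw [h]
    · exact hF ⟨_, h.1⟩
  let q (i : S) : T.Path (pred i) i := (Nonempty.some (hq i)).toPath
  have hqU {i : S} {e : Sym2 V} (he : e ∈ (q i).1.edges) : e ∈ U := by
    have := SimpleGraph.edgeSet_mono hTF ((q i).1.edges_subset_edgeSet he)
    rw [SimpleGraph.edgeSet_fromEdgeSet] at this
    exact this.1
  have hcount := (hG.mono (hTF.trans hFG)).card_filter_mem_edges_le_two hπ hT hp2
    (fun i j hij => hp3 j i i.2 hij) q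
  calc outcomeCost c P
      ≤ ∑ i : S, playerCost (orderedProtocol c π) P i := outcomeCost_le_sum_playerCost P
    _ ≤ ∑ i : S, ∑ e ∈ (q i).1.edges.toFinset, c e := by
        refine Finset.sum_le_sum fun i _ => ?_
        have := hP.playerCost_le (hp1 i) ((q i).1.mapLe (hTF.trans hFG))
        rwa [SimpleGraph.Walk.edges_mapLe_eq_edges] at this
    _ = ∑ e ∈ U, ∑ i : S with e ∈ (q i).1.edges, c e := by
        refine Finset.sum_comm' fun i e => ?_
        simp only [Finset.mem_univ, true_and, List.mem_toFinset, Finset.mem_filter]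
        exact ⟨fun h => ⟨h, hqU h⟩, fun h => h.1⟩
    _ ≤ ∑ e ∈ U, 2 * c e := by
        refine Finset.sum_le_sum fun e _ => ?_
        rw [Finset.sum_const, nsmul_eq_mul]
        exact mul_le_mul_left (by exact_mod_cast hcount e) _
    _ = 2 * outcomeCost c P' := (Finset.mul_sum _ _ _).symm

theorem priceOfAnarchy_le_two (hG : NonCrossing G π) (hπ : Function.Injective π) (h0 : π t = 0) :
    priceOfAnarchy G t c (orderedProtocol c π) ≤ 2 := by
  refine iSup_le fun S => iSup_le fun hS => iSup_le fun P => iSup_le fun hP => ?_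
  -- The product form also settles an optimum of zero.
  refine ENNReal.div_le_of_le_mul ?_
  rw [optCost, ENNReal.mul_iInf_of_ne two_ne_zero (ENNReal.ofNat_ne_top)]
  refine le_iInf fun P' => ?_
  exact_mod_cast hP.outcomeCost_le hG hπ h0 hS P'

end Game

end Multicast

/-! ### The theorem -/

open Multicast in
theorem mainTheorem4 {V : Type*} [Fintype V] [DecidableEq V] (hV : 3 ≤ Fintype.card V)
    (G : SimpleGraph V) (hconn : G.Connected) (hG : Multicast.IsOuterplanar G)
    (c : Sym2 V → ℝ≥0) (t : V) :
    (∃ H : SimpleGraph V, G ≤ H ∧ Multicast.IsBiconnected H ∧ Multicast.IsOuterplanar H) ∧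
    ∀ H : SimpleGraph V, G ≤ H → Multicast.IsBiconnected H → Multicast.IsOuterplanar H →
      (∃ p : H.Walk t t, p.IsHamiltonianCycle) ∧
      (∀ p q : H.Walk t t, p.IsHamiltonianCycle → q.IsHamiltonianCycle →
        ∀ e : Sym2 V, e ∈ p.edges ↔ e ∈ q.edges) ∧
      ∀ p : H.Walk t t, p.IsHamiltonianCycle →
        (∀ S : Finset V, t ∉ S →
          ∃ P : Multicast.Outcome G t S, Multicast.IsNash (Multicast.tourProtocol c p) P) ∧
        Multicast.priceOfAnarchy G t c (Multicast.tourProtocol c p) ≤ 8 := by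
  obtain ⟨k, hk⟩ := Nat.exists_eq_add_of_le' hV
  refine ⟨?_, fun H hGH hH ⟨d, hd, hd'⟩ => ?_⟩
  · obtain ⟨d, hd, hd'⟩ := hG
    obtain ⟨σ, hσ⟩ := exists_equiv_drawing_iff hk d hd
    -- The drawing of `G` serves unchanged for the larger graph.
    exact ⟨G ⊔ cyclicGraph σ, le_sup_left, (isBiconnected_cyclicGraph σ).mono le_sup_right, d, hd,
      (hσ _).2 ((hσ G).1 hd').sup_cyclicGraph⟩
  obtain ⟨σ, hσ⟩ := exists_equiv_drawing_iff hk d hd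
  have hHσ : NonCrossing H σ := (hσ H).1 hd'
  have tour (p : H.Walk t t) (hp : p.IsHamiltonianCycle) : ∃ τ : V ≃ Fin (k + 3),
      (∀ v, (τ v).val = tourPosition p v) ∧ NonCrossing H τ ∧
        ∀ u v, s(u, v) ∈ p.edges ↔ (cyclicGraph σ).Adj u v := by
    obtain ⟨τ, hτ, hτ'⟩ := exists_equiv_tourPosition hk hp
    obtain ⟨h1, h2⟩ := hHσ.of_cyclicGraph_le (τ := τ)
      fun u v huv => p.adj_of_mem_edges ((hτ' u v).2 huv)
    exact ⟨τ, hτ, h2, h1 ▸ hτ'⟩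
  refine ⟨exists_isHamiltonianCycle_of_cyclicGraph_le (hHσ.cyclicGraph_le hH) t,
    fun p q hp hq e => ?_, fun p hp => ?_⟩
  · induction e with | h u v =>
    obtain ⟨-, -, -, hp'⟩ := tour p hp
    obtain ⟨-, -, -, hq'⟩ := tour q hq
    rw [hp', hq']
  · obtain ⟨τ, hτ, hcross, -⟩ := tour p hp
    have hinj : Function.Injective (tourPosition p) := fun u v huv =>
      τ.injective (Fin.ext (by rw [hτ, hτ, huv]))
    refine ⟨fun S _ => exists_isNash hconn c hinj, ?_⟩
    have hpos : NonCrossing G (tourPosition p) := by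
      intro a b x y hab hxy
      simp only [← hτ, ← Fin.lt_def]
      exact hcross a b x y (hGH hab) (hGH hxy)
    have h0 : tourPosition p t = 0 := by
      rw [tourPosition, ← p.cons_tail_support, List.idxOf_cons_self]
    -- The argument proves the bound 2, which is stronger than 8.
    exact (priceOfAnarchy_le_two hpos hinj h0).trans (by norm_num)
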